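/- Identify a set partition of $[n]=\{1,\dots,n\}$, whose blocks $B_1,\dots,B_d$ are listed so that $\min B_1<\dots<\min B_d$, with its canonical sequence $\pi=\pi_1\cdots\pi_n$, where $\pi_i=j$ if and only if $i\in B_j$. Such a $\pi$ contains a sequence $\sigma=\sigma_1\cdots\sigma_m$ if there are indices $1\le f(1)<\dots<f(m)\le n$ such that, for all $i,j\in[m]$, $\pi_{f(i)}<\pi_{f(j)}$ if and only if $\sigma_i<\sigma_j$; otherwise $\pi$ avoids $\sigma$. Two partitions $\sigma,\sigma'$ are equivalent if, for every $n\ge 0$, the number of partitions of $[n]$ avoiding $\sigma$ equals the number of partitions of $[n]$ avoiding $\sigma'$. For a sequence $\tau$, let $\tau+k$ denote the sequence obtained by adding $k$ to each term of $\tau$, and let $1^p21^q$ denote the sequence of $p$ ones, followed by a $2$, followed by $q$ ones. **Theorem.** Let $k\ge 0$, let $T$ be an arbitrary (possibly empty) finite sequence over the alphabet $[k]=\{1,\dots,k\}$, and let $p\ge 1$ and $q\ge 0$ be integers. Then $$\sigma=12\cdots k\,(1^p21^q+k)\,T\qquad\text{and}\qquad \sigma'=12\cdots k\,(1^{p+q}2+k)\,T$$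 are (canonical sequences of) partitions, and $\sigma$ is equivalent to $\sigma'$. -/

import Mathlib

namespace PartitionPattern

/-- A set partition of an `n`-element linearly ordered ground set (here `Fin n`, order-isomorphic
to `{1, …, n}`): a collection of disjoint nonempty blocks whose union is everything. -/
abbrev SetPartition (n : ℕ) := Finpartition (Finset.univ : Finset (Fin n))

/-- The canonical sequence of a set partition. List the blocks as `B₁, B₂, …` in increasing order
of their minima; the `i`-th letter is the index of the block containing `i`, that is, the number
of blocks whose minimum is at most the minimum of the block of `i`. Letters start at `1`. -/
def canonicalSeq {n : ℕ} (P : SetPartition n) (i : Fin n) : ℕ :=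
  (P.parts.filter fun B => B.min ≤ (P.part i).min).card

/-- The finite word `σ` is the canonical sequence of some set partition of `{1, …, |σ|}`. -/
def IsPartitionWord (σ : List ℕ) : Prop :=
  ∃ P : SetPartition σ.length, ∀ i, canonicalSeq P i = σ.get i

/-- The sequence `π` has a subsequence that is order-isomorphic to the word `σ`. -/
def Contains {n : ℕ} (π : Fin n → ℕ) (σ : List ℕ) : Prop :=
  ∃ f : Fin σ.length → Fin n, StrictMono f ∧
    ∀ i j, π (f i) < π (f j) ↔ σ.get i < σ.get j

/-- The set `P(n; σ)` of the partitions of `{1, …, n}` that avoid `σ`. -/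
def avoiders (n : ℕ) (σ : List ℕ) : Set (SetPartition n) :=
  {P | ¬ Contains (canonicalSeq P) σ}

/-- Equivalence of patterns: `p(n; σ) = p(n; σ')` for every `n`. -/
def Equivalent (σ σ' : List ℕ) : Prop :=
  ∀ n : ℕ, (avoiders n σ).ncard = (avoiders n σ').ncard

/-- The word `1^p 2 1^q`. -/
def oneTwoOne (p q : ℕ) : List ℕ :=
  List.replicate p 1 ++ [2] ++ List.replicate q 1

/-- The word `τ + k`, obtained by adding `k` to every letter of `τ`. -/
def shift (τ : List ℕ) (k : ℕ) : List ℕ :=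
  τ.map (· + k)

/-- The word `12⋯k (1^p 2 1^q + k) T`. -/
def pattern (k p q : ℕ) (T : List ℕ) : List ℕ :=
  List.range' 1 k ++ shift (oneTwoOne p q) k ++ T

end PartitionPattern

namespace PartitionPattern

/-! Canonical sequences are exactly the restricted growth words. In such a word the letters `1, …, c
- 1` occur in order before the first `c`, so the prefix `12⋯k` of the pattern comes for free: only
the tail `(1^p 2 1^q + k) T` matters (`contains_pattern_iff`).

Fix the value `c` playing the role of `k + 1`. The part `1^p 2 1^q` must lie in the longest prefix
still followed by a copy of `T` in letters below `c`. Mark there each `c` by `true`, each larger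
letter by `false`, and skip smaller ones; a tail exists iff some such row word contains `1^p 0 1^q`
(`hasTail_iff_rowWord`).

Reversing a binary word after its `p`-th `true` exchanges the subsequences `1^p 0 1^q` and `1^(p+q)
0`. `flipRow` does this to one row, fixing the smaller letters and the relative order of the larger
ones. It is an involution that leaves the prefixes and all other row words intact, so rows can be
converted one at a time (`ncard_mixedAvoiders_succ`). A word of length `n` has no letter above `n`,
so `n` flips suffice. -/

/-! ### Partial reversal of binary words -/

/-- Reverse the part of a binary word that follows its `p`-th `true`. -/
def revAfter : ℕ → List Bool → List Bool
  | 0, w => w.reverse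
  | _ + 1, [] => []
  | p + 1, true :: w => true :: revAfter p w
  | p + 1, false :: w => false :: revAfter (p + 1) w

theorem revAfter_revAfter (p : ℕ) (w : List Bool) : revAfter p (revAfter p w) = w := by
  fun_induction revAfter p w <;> simp_all [revAfter]

theorem revAfter_perm (p : ℕ) (w : List Bool) : (revAfter p w).Perm w := by
  fun_induction revAfter p w <;> simp_all [List.reverse_perm]

theorem head?_revAfter {p : ℕ} (hp : 1 ≤ p) {w : List Bool} (hw : ∀ b ∈ w.head?, b = true) :
    (revAfter p w).head? = w.head? := by
  obtain ⟨p, rfl⟩ := Nat.exists_eq_add_of_le' hp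
  rcases w with _ | ⟨b, w⟩
  · rfl
  · obtain rfl : b = true := hw b rfl
    rfl

/-- The copy of `1^p` may be taken leftmost, so `s` is sought only after the `p`-th `true`, where
the word is reversed. With fewer than `p` letters `true`, neither side holds. -/
theorem replicate_append_sublist_revAfter (p : ℕ) (w s : List Bool) :
    (List.replicate p true ++ s.reverse).Sublist (revAfter p w) ↔
      (List.replicate p true ++ s).Sublist w := by
  fun_induction revAfter p w with
  | case1 w => simp
  | case2 p => simp [List.replicate_succ]
  | case3 p w ih => simpa [List.replicate_succ] using ih
  | case4 p w ih =>
    simp only [List.replicate_succ, List.cons_append] at ih ⊢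
    rw [List.sublist_cons_iff, List.sublist_cons_iff]
    simpa using ih

/-! ### Row words and refilling -/

/-- The positions of the letter `c` among the letters that are at least `c`. -/
def word (c : ℕ) (l : List ℕ) : List Bool :=
  (l.filter (c ≤ ·)).map (fun x => decide (x = c))

theorem word_append (c : ℕ) (l m : List ℕ) : word c (l ++ m) = word c l ++ word c m := by
  simp [word]

/-- Refill the places of `l` holding letters at least `r`: the places marked by `true` in `w`
receive `r`, the other ones receive the letters of `z` in order. -/
def refill (r : ℕ) : List ℕ → List Bool → List ℕ → List ℕ
  | [], _, _ => []
  | a :: l, w, z =>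
    if a < r then a :: refill r l w z
    else match w, z with
      | true :: w, z => r :: refill r l w z
      | false :: w, b :: z => b :: refill r l w z
      | _, _ => []

/-- The length conditions keep `refill` out of its fallback branch. The three conclusions control
the rows below, above and at `r` respectively. -/
theorem refill_spec (r : ℕ) (l : List ℕ) (w : List Bool) (z : List ℕ)
    (hw : w.length = (l.filter (r ≤ ·)).length) (hz : z.length = w.count false)
    (hzr : ∀ b ∈ z, r < b) :
    (refill r l w z).map (min · r) = l.map (min · r) ∧
      (refill r l w z).filter (r < ·) = z ∧ word r (refill r l w z) = w := by
  induction l generalizing w z with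
  | nil =>
    simp at hw; subst hw
    simp at hz; subst hz
    simp [refill, word]
  | cons a l ih =>
    by_cases h : a < r
    · have := ih w z (by simpa [List.filter_cons, not_le.2 h] using hw) hz hzr
      simp [refill, h, word, not_le.2 h, not_lt.2 h.le] at this ⊢
      exact this
    · have h' := not_lt.1 h
      simp only [List.filter_cons, h', decide_true, if_true, List.length_cons] at hw
      rcases w with _ | ⟨b, w⟩
      · simp at hw
      rcases b
      · rcases z with _ | ⟨b, z⟩
        · simp at hz
        have hb := hzr b (by simp)
        have := ih w z (by simpa using hw) (by simpa using hz) (fun x hx => hzr x (by simp [hx]))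
        simp [refill, h, word, hb, hb.le, hb.ne', h'] at this ⊢
        exact this
      · have := ih w z (by simpa using hw) (by simpa using hz) hzr
        simp [refill, h, word, h'] at this ⊢
        exact this

theorem refill_self (r : ℕ) (l : List ℕ) :
    refill r l (word r l) (l.filter (r < ·)) = l := by
  induction l with
  | nil => rfl
  | cons a l ih =>
    rcases lt_trichotomy a r with h | h | h
    · simpa [refill, word, h, not_le.2 h, not_lt.2 h.le] using ih
    · simpa [refill, word, h] using ih
    · simpa [refill, word, h, not_lt.2 h.le, h.le, h.ne'] using ih

theorem refill_congr (r : ℕ) {l l' : List ℕ} (h : l.map (min · r) = l'.map (min · r))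
    (w : List Bool) (z : List ℕ) : refill r l w z = refill r l' w z := by
  induction l generalizing l' w z with
  | nil => simp at h; subst h; rfl
  | cons a l ih =>
    rcases l' with _ | ⟨a', l'⟩
    · simp at h
    simp only [List.map_cons, List.cons.injEq] at h
    by_cases h' : a < r
    · have : a' = a := by omega
      subst this
      simp [refill, h', ih h.2]
    · have h2 : ¬ a' < r := by omega
      unfold refill
      simp only [h', h2, if_false, ih h.2]

theorem word_map_min {c r : ℕ} (h : c < r) (l : List ℕ) : word c (l.map (min · r)) = word c l := by
  simp only [word, List.filter_map, List.map_map]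
  congr 1
  · funext x; simp; omega
  · congr 1; funext x; simp; omega

theorem filter_le_filter_lt {c r : ℕ} (h : r < c) (l : List ℕ) :
    (l.filter (r < ·)).filter (c ≤ ·) = l.filter (c ≤ ·) := by
  rw [List.filter_filter]
  congr 1; funext x; simp; omega

theorem count_false_word (r : ℕ) (l : List ℕ) :
    (word r l).count false = (l.filter (r < ·)).length := by
  induction l with
  | nil => rfl
  | cons a l ih =>
    rcases lt_trichotomy a r with h | h | h
    · simpa [word, h, not_le.2 h, not_lt.2 h.le] using ih
    · simpa [word, h] using ih
    · simpa [word, h, h.le, h.ne'] using ih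

/-! ### Places followed by a copy of `T` -/

/-- Some letters `1 ≤ a 1 < ⋯ < a k < c` are such that the word `T`, with each letter `t` replaced
by `a t`, occurs in `l` after the first `j` places. -/
def Followed (k : ℕ) (T l : List ℕ) (c j : ℕ) : Prop :=
  ∃ a : ℕ → ℕ, StrictMonoOn a (Set.Iic k) ∧ a k < c ∧ (T.map a).Sublist (l.drop j)

theorem Followed.mono {k : ℕ} {T l : List ℕ} {c c' j j' : ℕ} (h : Followed k T l c j)
    (hc : c ≤ c') (hj : j' ≤ j) : Followed k T l c' j' := by
  obtain ⟨a, h1, h2, h3⟩ := h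
  exact ⟨a, h1, h2.trans_le hc, h3.trans (List.drop_sublist_drop_left _ hj)⟩

open Classical in
/-- The number of places of row `c` that are followed by a copy of `T` in lower rows. -/
noncomputable def width (k : ℕ) (T l : List ℕ) (c : ℕ) : ℕ :=
  Nat.findGreatest (Followed k T l c) l.length

theorem width_le_length (k : ℕ) (T l : List ℕ) (c : ℕ) : width k T l c ≤ l.length := by
  classical exact Nat.findGreatest_le _

theorem followed_width {k : ℕ} {T l : List ℕ} {c : ℕ} (h : width k T l c ≠ 0) :
    Followed k T l c (width k T l c) := by
  classical exact Nat.findGreatest_of_ne_zero rfl h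

theorem le_width {k : ℕ} {T l : List ℕ} {c j : ℕ} (hj : j ≤ l.length) (h : Followed k T l c j) :
    j ≤ width k T l c := by
  classical exact Nat.le_findGreatest hj h

theorem width_mono (k : ℕ) (T l : List ℕ) {c c' : ℕ} (h : c ≤ c') :
    width k T l c ≤ width k T l c' := by
  by_cases h0 : width k T l c = 0
  · simp [h0]
  · exact le_width (width_le_length ..) ((followed_width h0).mono h le_rfl)

/-- The word of row `c` restricted to the places followed by a copy of `T`. -/
noncomputable def rowWord (k : ℕ) (T l : List ℕ) (c : ℕ) : List Bool :=
  word c (l.take (width k T l c))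

/-! ### Flipping one row -/

/-- Reverse the word of row `r` after its `p`-th `true`, keeping the order of the larger letters. -/
noncomputable def flipRow (k p : ℕ) (T : List ℕ) (r : ℕ) (l : List ℕ) : List ℕ :=
  refill r (l.take (width k T l r)) (revAfter p (rowWord k T l r))
    ((l.take (width k T l r)).filter (r < ·)) ++ l.drop (width k T l r)

section flipRow

variable (k p : ℕ) (T : List ℕ) (r : ℕ) (l : List ℕ)

theorem exists_flipRow_eq :
    ∃ u u' v, l = u ++ v ∧ flipRow k p T r l = u' ++ v ∧ u.length = width k T l r ∧
      u'.map (min · r) = u.map (min · r) ∧ u'.filter (r < ·) = u.filter (r < ·) ∧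
      word r u' = revAfter p (word r u) ∧
      u' = refill r u (revAfter p (word r u)) (u.filter (r < ·)) := by
  obtain ⟨h1, h2, h3⟩ := refill_spec r (l.take (width k T l r)) (revAfter p (rowWord k T l r))
    ((l.take (width k T l r)).filter (r < ·))
    (by rw [(revAfter_perm p _).length_eq]; simp [rowWord, word])
    (by rw [(revAfter_perm p _).count_eq, rowWord, count_false_word])
    (by simp)
  exact ⟨_, _, _, (List.take_append_drop _ l).symm, rfl,
    by simp [width_le_length], h1, h2, h3, rfl⟩

theorem map_min_flipRow : (flipRow k p T r l).map (min · r) = l.map (min · r) := by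
  obtain ⟨u, u', v, h, h', -, h1, -⟩ := exists_flipRow_eq k p T r l
  rw [h', h, List.map_append, List.map_append, h1]

theorem length_flipRow : (flipRow k p T r l).length = l.length := by
  simpa using congrArg List.length (map_min_flipRow k p T r l)

theorem sublist_of_map_min_eq {s m m' : List ℕ} (h : m.map (min · r) = m'.map (min · r))
    (hs : ∀ x ∈ s, x < r) (hm : s.Sublist m) : s.Sublist m' := by
  have key : ∀ m : List ℕ, (m.map (min · r)).filter (· < r) = m.filter (· < r) := by
    intro m
    induction m with
    | nil => rfl
    | cons a m ih =>
      by_cases h : a < r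
      · simp [h, h.le] at ih ⊢; exact ih
      · simp [h] at ih ⊢; exact ih
  have h1 : (s.filter (· < r)).Sublist (m.filter (· < r)) := hm.filter _
  rw [List.filter_eq_self.2 (by simpa using hs), ← key, h, key] at h1
  exact h1.trans List.filter_sublist

/-- From a place beyond `u`, only the common part `v` is seen. From a place inside `u`, if `r ≤ c`
the copy of `T` in `v` given by `hv` serves; if `c < r` the copy uses only letters below `r`, which
have not moved. -/
theorem followed_of_eq_append {T u u' v : List ℕ} (hT : ∀ t ∈ T, t ≤ k) {c j : ℕ}
    (h1 : u'.map (min · r) = u.map (min · r))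
    (hv : u ≠ [] → Followed k T (u' ++ v) r u'.length) (h : Followed k T (u ++ v) c j) :
    Followed k T (u' ++ v) c j := by
  have hl : u'.length = u.length := by simpa using congrArg List.length h1
  rcases le_or_gt u.length j with hj | hj
  · obtain ⟨a, ha, hc, hs⟩ := h
    refine ⟨a, ha, hc, ?_⟩
    rw [List.drop_append, List.drop_eq_nil_of_le (by omega)] at hs ⊢
    rwa [hl]
  rcases le_or_gt r c with hc | hc
  · exact (hv (by rintro rfl; simp at hj)).mono hc (by omega)
  · obtain ⟨a, ha, hac, hs⟩ := h
    refine ⟨a, ha, hac, sublist_of_map_min_eq r ?_ ?_ hs⟩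
    · rw [List.map_drop, List.map_drop, List.map_append, List.map_append, h1]
    · intro x hx
      obtain ⟨t, ht, rfl⟩ := List.mem_map.1 hx
      have := ha.monotoneOn (hT t ht) (Set.mem_Iic.2 le_rfl) (hT t ht)
      omega

theorem followed_flipRow (hT : ∀ t ∈ T, t ≤ k) (c j : ℕ) :
    Followed k T (flipRow k p T r l) c j ↔ Followed k T l c j := by
  obtain ⟨u, u', v, h, h', hw, h1, -⟩ := exists_flipRow_eq k p T r l
  have hl : u'.length = u.length := by simpa using congrArg List.length h1
  have key : u ≠ [] → Followed k T (u ++ v) r u.length := by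
    intro hu
    rw [hw, ← h]
    exact followed_width (by rw [← hw]; simpa using hu)
  have key' : u ≠ [] → Followed k T (u' ++ v) r u'.length := by
    intro hu
    simpa [Followed] using key hu
  rw [h', h]
  refine ⟨followed_of_eq_append k r hT h1.symm fun hu => key ?_,
    followed_of_eq_append k r hT h1 key'⟩
  rintro rfl
  simp at hl
  exact hu hl

theorem width_flipRow (hT : ∀ t ∈ T, t ≤ k) (c : ℕ) :
    width k T (flipRow k p T r l) c = width k T l c := by
  unfold width
  rw [length_flipRow]
  congr 1
  funext j
  exact propext (followed_flipRow k p T r l hT c j)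

theorem rowWord_flipRow_self (hT : ∀ t ∈ T, t ≤ k) :
    rowWord k T (flipRow k p T r l) r = revAfter p (rowWord k T l r) := by
  obtain ⟨u, u', v, h, h', hw, h1, -, h3, -⟩ := exists_flipRow_eq k p T r l
  have hl : u'.length = u.length := by simpa using congrArg List.length h1
  rw [rowWord, rowWord, width_flipRow k p T r l hT, ← hw, h', List.take_left' hl]
  conv_rhs => rw [h, List.take_left' rfl]
  exact h3

/-- A lower row sees all letters from `r` up as equal, and these keep their places as a set. A
higher row has a prefix containing the flipped one, and sees only letters above `r`, whose order is
kept. -/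
theorem rowWord_flipRow_of_ne (hT : ∀ t ∈ T, t ≤ k) {c : ℕ} (hc : c ≠ r) :
    rowWord k T (flipRow k p T r l) c = rowWord k T l c := by
  rw [rowWord, rowWord, width_flipRow k p T r l hT]
  rcases lt_or_gt_of_ne hc with hc | hc
  · rw [← word_map_min hc, List.map_take, map_min_flipRow, ← List.map_take, word_map_min hc]
  · obtain ⟨u, u', v, h, h', hw, h1, h2, -⟩ := exists_flipRow_eq k p T r l
    have hl : u'.length = u.length := by simpa using congrArg List.length h1
    have hle := width_mono k T l hc.le
    rw [← hw] at hle
    rw [h']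
    conv_rhs => arg 2; arg 2; rw [h]
    rw [List.take_append, List.take_append, List.take_of_length_le (by omega),
      List.take_of_length_le hle, hl, word_append, word_append, word, word, word,
      ← filter_le_filter_lt hc u', h2, filter_le_filter_lt hc]

theorem flipRow_flipRow (hT : ∀ t ∈ T, t ≤ k) : flipRow k p T r (flipRow k p T r l) = l := by
  obtain ⟨u, u', v, h, h', hw, h1, h2, h3, -⟩ := exists_flipRow_eq k p T r l
  have hl : u'.length = u.length := by simpa using congrArg List.length h1
  rw [flipRow, rowWord_flipRow_self k p T r l hT, revAfter_revAfter,
    width_flipRow k p T r l hT, ← hw, h', List.take_left' hl, List.drop_left' hl, h2,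
    refill_congr r h1, rowWord, ← hw]
  conv_rhs => rw [h]
  rw [h, List.take_left' rfl, refill_self]

end flipRow

/-! ### Restricted growth and tails -/

/-- The list is a restricted growth word: its letters are positive, and the first letter that is
at least `c` equals `c`. -/
def IsRestrictedGrowth (l : List ℕ) : Prop :=
  (∀ x ∈ l, 1 ≤ x) ∧ ∀ c, 1 ≤ c → ∀ x ∈ (l.filter (c ≤ ·)).head?, x = c

theorem head?_filter_iff_word (c : ℕ) (l : List ℕ) :
    (∀ x ∈ (l.filter (c ≤ ·)).head?, x = c) ↔ ∀ b ∈ (word c l).head?, b = true := by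
  unfold word
  rcases l.filter (c ≤ ·) with _ | ⟨a, m⟩ <;> simp

theorem IsRestrictedGrowth.flipRow {k p : ℕ} {T : List ℕ} {r : ℕ} {l : List ℕ} (hp : 1 ≤ p)
    (hr : 1 ≤ r) (hl : IsRestrictedGrowth l) :
    IsRestrictedGrowth (flipRow k p T r l) := by
  refine ⟨fun x hx => ?_, fun c hc => ?_⟩
  · have : min x r ∈ (PartitionPattern.flipRow k p T r l).map (min · r) :=
      List.mem_map_of_mem hx
    rw [map_min_flipRow] at this
    obtain ⟨y, hy, hxy⟩ := List.mem_map.1 this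
    have := hl.1 y hy
    omega
  have hlc := hl.2 c hc
  rw [head?_filter_iff_word] at hlc ⊢
  rcases lt_trichotomy c r with h | rfl | h
  · rwa [← word_map_min h, map_min_flipRow, word_map_min h]
  · obtain ⟨u, u', v, h, h', hw, h1, h2, h3, -⟩ := exists_flipRow_eq k p T c l
    rw [h, word_append] at hlc
    have : ∀ b ∈ (word c u).head?, b = true := by
      intro b hb
      exact hlc b (by simp_all [List.head?_append])
    -- Since `1 ≤ p`, the first `true` of the row word stays in front.
    rw [h', word_append, h3, List.head?_append, head?_revAfter hp this, ← List.head?_append]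
    exact hlc
  · obtain ⟨u, u', v, h0, h', hw, h1, h2, h3, -⟩ := exists_flipRow_eq k p T r l
    rw [h', word_append, word, ← filter_le_filter_lt h, h2, filter_le_filter_lt h, ← word,
      ← word_append, ← h0]
    exact hlc

/-- The list contains a copy of `(1^p 2 1^q + k) T`, with `T` over the letters `1, …, k`. -/
def HasTail (k p q : ℕ) (T l : List ℕ) : Prop :=
  ∃ (a : ℕ → ℕ) (c d : ℕ), StrictMonoOn a (Set.Iic k) ∧ a k < c ∧ c < d ∧
    (List.replicate p c ++ d :: List.replicate q c ++ T.map a).Sublist l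

theorem hasTail_iff_rowWord (k p q : ℕ) (T l : List ℕ) :
    HasTail k p q T l ↔
      ∃ c, (List.replicate p true ++ false :: List.replicate q true).Sublist
        (rowWord k T l (c + 1)) := by
  constructor
  · rintro ⟨a, c, d, ha, hac, hcd, hs⟩
    obtain ⟨c, rfl⟩ := Nat.exists_eq_add_of_le' (Nat.one_le_of_lt hac)
    refine ⟨c, ?_⟩
    obtain ⟨l₁, l₂, rfl, h1, h2⟩ := List.append_sublist_iff.1 hs
    have hw : l₁.length ≤ width k T (l₁ ++ l₂) (c + 1) :=
      le_width (by simp) ⟨a, ha, hac, by simpa using h2⟩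
    have h3 : l₁.Sublist ((l₁ ++ l₂).take (width k T (l₁ ++ l₂) (c + 1))) := by
      rw [List.take_append, List.take_of_length_le hw]
      exact List.sublist_append_left _ _
    have h4 := ((h1.trans h3).filter (c + 1 ≤ ·)).map (fun x => decide (x = c + 1))
    have h5 : List.map (fun x => decide (x = c + 1)) (List.filter (c + 1 ≤ ·)
        (List.replicate p (c + 1) ++ d :: List.replicate q (c + 1))) =
        List.replicate p true ++ false :: List.replicate q true := by
      have hcd' : c < d := by omega
      simp [hcd', hcd.ne']
    rw [h5] at h4
    exact h4
  · rintro ⟨c, hs⟩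
    rw [rowWord, word, List.sublist_map_iff] at hs
    obtain ⟨s, hs, hw⟩ := hs
    obtain ⟨s₁, s', rfl, h1, h2⟩ := List.append_eq_map_iff.1 hw
    obtain ⟨d, s₂, rfl, h3, h4⟩ := List.map_eq_cons_iff.1 h2
    have hrep : ∀ (m : List ℕ) (n : ℕ),
        m.map (fun x => decide (x = c + 1)) = List.replicate n true →
        m = List.replicate n (c + 1) := by
      intro m n hm
      rw [List.eq_replicate_iff] at hm ⊢
      simpa using hm
    rw [hrep _ _ h1, hrep _ _ h4] at hs
    have hd : c + 1 < d := by
      have h5 : d ∈ (l.take (width k T l (c + 1))).filter (c + 1 ≤ ·) := hs.subset (by simp)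
      have h6 := (List.mem_filter.1 h5).2
      simp at h3 h6
      omega
    -- The width is `0` also when no copy of `T` exists; this is harmless, as an empty prefix cannot
    -- contain the `false` of the pattern.
    have h0 : width k T l (c + 1) ≠ 0 := by
      intro h0
      simp [h0] at hs
    obtain ⟨a, ha, hac, ht⟩ := followed_width h0
    refine ⟨a, c + 1, d, ha, hac, hd, ?_⟩
    rw [← List.take_append_drop (width k T l (c + 1)) l]
    exact (hs.trans List.filter_sublist).append ht

/-- Cut at the first `x`: the letter `x - 1`, if positive, must already have occurred, so induction
applies to the initial part. -/
theorem IsRestrictedGrowth.exists_eq_append {l : List ℕ} (hl : IsRestrictedGrowth l) {x : ℕ}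
    (hx : x ∈ l) : ∃ l₁ l₂, l = l₁ ++ x :: l₂ ∧ x ∉ l₁ ∧ (List.range' 1 (x - 1)).Sublist l₁ := by
  induction x generalizing l with
  | zero => exact absurd (hl.1 0 hx) (by simp)
  | succ x ih =>
    obtain ⟨l₁, l₂, rfl, hn⟩ := List.eq_append_cons_of_mem hx
    refine ⟨l₁, l₂, rfl, hn, ?_⟩
    rcases Nat.eq_zero_or_pos x with rfl | h0
    · simp
    have h1 : ∀ c, 1 ≤ c → ∀ y ∈ (l₁.filter (c ≤ ·)).head?, y = c := by
      intro c hc y hy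
      refine hl.2 c hc y ?_
      simp_all [List.head?_append]
    have hl₁ : IsRestrictedGrowth l₁ := ⟨fun y hy => hl.1 y (by simp [hy]), h1⟩
    have hxl : x ∈ l₁ := by
      have h2 := hl.2 x h0
      have h3 := h1 x h0
      rw [List.filter_append, List.head?_append] at h2
      rcases h4 : l₁.filter (x ≤ ·) with _ | ⟨b, m⟩
      · rw [h4] at h2
        simp at h2
      · rw [h4] at h3
        have h5 : b ∈ l₁.filter (x ≤ ·) := by simp [h4]
        rw [← h3 b rfl]
        exact (List.mem_filter.1 h5).1
    obtain ⟨m₁, m₂, rfl, -, hm⟩ := ih hl₁ hxl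
    obtain ⟨x, rfl⟩ := Nat.exists_eq_add_of_le' h0
    simp only [Nat.add_sub_cancel] at hm ⊢
    rw [List.range'_concat]
    refine hm.append ?_
    rw [Nat.one_mul, Nat.add_comm 1 x]
    simp

theorem IsRestrictedGrowth.le_length {l : List ℕ} (hl : IsRestrictedGrowth l) {x : ℕ}
    (hx : x ∈ l) : x ≤ l.length := by
  obtain ⟨l₁, l₂, rfl, -, h⟩ := hl.exists_eq_append hx
  have := h.length_le
  simp at this ⊢
  omega

/-! ### Converting the rows one by one -/

/-- The restricted growth words of length `n` whose row words, in the rows up to `i`, avoid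
`1^(p+q) 2`, and in the other rows, avoid `1^p 2 1^q`. -/
def mixedAvoiders (k p q : ℕ) (T : List ℕ) (n i : ℕ) : Set (List ℕ) :=
  {l | IsRestrictedGrowth l ∧ l.length = n ∧
    ∀ c, ¬ (List.replicate p true ++
      if c < i then List.replicate q true ++ [false] else false :: List.replicate q true).Sublist
        (rowWord k T l (c + 1))}

theorem ncard_mixedAvoiders_succ {k p q : ℕ} (hp : 1 ≤ p) {T : List ℕ} (hT : ∀ t ∈ T, t ≤ k)
    (n i : ℕ) :
    (mixedAvoiders k p q T n (i + 1)).ncard = (mixedAvoiders k p q T n i).ncard := by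
  have hinv : Function.Involutive (flipRow k p T (i + 1)) :=
    fun l => flipRow_flipRow k p T (i + 1) l hT
  have hA : ∀ w : List Bool,
      (List.replicate p true ++ (List.replicate q true ++ [false])).Sublist (revAfter p w) ↔
      (List.replicate p true ++ false :: List.replicate q true).Sublist w := by
    intro w
    simpa using replicate_append_sublist_revAfter p w (false :: List.replicate q true)
  have key : ∀ l, flipRow k p T (i + 1) l ∈ mixedAvoiders k p q T n (i + 1) ↔
      l ∈ mixedAvoiders k p q T n i := by
    intro l
    refine and_congr ⟨fun h => ?_, fun h => h.flipRow hp (by simp)⟩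
      (and_congr (by rw [length_flipRow]) (forall_congr' fun c => not_congr ?_))
    · rw [← hinv l]
      exact h.flipRow hp (by simp)
    · rcases eq_or_ne c i with rfl | hc
      · rw [rowWord_flipRow_self k p T _ l hT, if_pos (by omega), if_neg (by omega), hA]
      · rw [rowWord_flipRow_of_ne k p T _ l hT (by omega)]
        have : c < i + 1 ↔ c < i := by omega
        simp only [this]
  have himg : mixedAvoiders k p q T n (i + 1) =
      flipRow k p T (i + 1) '' mixedAvoiders k p q T n i := by
    ext l
    rw [hinv.image_eq_preimage_symm, Set.mem_preimage, ← key, hinv l]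
  rw [himg, Set.ncard_image_of_injective _ hinv.injective]

theorem ncard_mixedAvoiders {k p q : ℕ} (hp : 1 ≤ p) {T : List ℕ} (hT : ∀ t ∈ T, t ≤ k)
    (n i : ℕ) :
    (mixedAvoiders k p q T n i).ncard = (mixedAvoiders k p q T n 0).ncard := by
  induction i with
  | zero => rfl
  | succ i ih => rw [ncard_mixedAvoiders_succ hp hT, ih]

theorem ncard_not_hasTail_eq {k p q : ℕ} (hp : 1 ≤ p) {T : List ℕ} (hT : ∀ t ∈ T, t ≤ k) (n : ℕ) :
    {l | IsRestrictedGrowth l ∧ l.length = n ∧ ¬ HasTail k p q T l}.ncard =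
      {l | IsRestrictedGrowth l ∧ l.length = n ∧ ¬ HasTail k (p + q) 0 T l}.ncard := by
  convert (ncard_mixedAvoiders (q := q) hp hT n n).symm using 2
  · ext l
    simp [mixedAvoiders, hasTail_iff_rowWord]
  · ext l
    refine and_congr_right fun hl => and_congr_right fun hn => ?_
    rw [hasTail_iff_rowWord, not_exists]
    refine forall_congr' fun c => ?_
    split_ifs with hc
    · rw [List.replicate_add, List.append_assoc]
      rfl
    -- Rows beyond `n` are empty and avoid both words.
    · have : rowWord k T l (c + 1) = [] := by
        simp only [rowWord, word, List.map_eq_nil_iff, List.filter_eq_nil_iff]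
        intro x hx
        have := hl.le_length (List.mem_of_mem_take hx)
        simp
        omega
      simp [this]

/-! ### From pattern containment to tails -/

theorem contains_iff_exists_map_sublist {n : ℕ} (π : Fin n → ℕ) (σ : List ℕ) :
    Contains π σ ↔
      ∃ b : ℕ → ℕ, StrictMonoOn b {t | t ∈ σ} ∧ (σ.map b).Sublist (List.ofFn π) := by
  constructor
  · rintro ⟨f, hf, h⟩
    have hfac : Function.FactorsThrough (π ∘ f) σ.get := by
      intro i j hij
      have h1 := h i j
      have h2 := h j i
      rw [hij] at h1 h2
      simp only [Function.comp_apply]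
      omega
    refine ⟨Function.extend σ.get (π ∘ f) 0, ?_, ?_⟩
    · intro s hs t ht hst
      obtain ⟨i, rfl⟩ := List.mem_iff_get.1 hs
      obtain ⟨j, rfl⟩ := List.mem_iff_get.1 ht
      rw [hfac.extend_apply, hfac.extend_apply]
      exact (h i j).2 hst
    · rw [List.sublist_iff_exists_fin_orderEmbedding_get_eq]
      refine ⟨OrderEmbedding.ofStrictMono
        (fun i => Fin.cast (List.length_ofFn).symm (f (Fin.cast (List.length_map _) i))) ?_, ?_⟩
      · intro i j hij
        exact hf hij
      · intro i
        have := hfac.extend_apply 0 (Fin.cast (List.length_map _) i)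
        simp only [Function.comp_apply] at this
        rw [List.get_ofFn, List.get_eq_getElem, List.getElem_map]
        exact this
  · rintro ⟨b, hb, hs⟩
    rw [List.sublist_iff_exists_fin_orderEmbedding_get_eq] at hs
    obtain ⟨f, hf⟩ := hs
    refine ⟨fun i => Fin.cast List.length_ofFn (f (Fin.cast (List.length_map _).symm i)), ?_, ?_⟩
    · intro i j hij
      exact f.strictMono hij
    · intro i j
      have key : ∀ i : Fin σ.length,
          π (Fin.cast List.length_ofFn (f (Fin.cast (List.length_map _).symm i))) =
            b (σ.get i) := by
        intro i
        have := hf (Fin.cast (List.length_map _).symm i)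
        rw [List.get_ofFn, List.get_eq_getElem, List.getElem_map] at this
        exact this.symm
      rw [key, key]
      exact hb.lt_iff_lt (List.get_mem ..) (List.get_mem ..)

theorem cons_sublist_of_append {x : ℕ} {s l₁ l₂ : List ℕ} (hx : x ∉ l₁)
    (h : (x :: s).Sublist (l₁ ++ x :: l₂)) : (x :: s).Sublist (x :: l₂) := by
  induction l₁ with
  | nil => exact h
  | cons y l₁ ih =>
    rw [List.mem_cons, not_or] at hx
    rw [List.cons_append, List.sublist_cons_iff] at h
    rcases h with h | ⟨_, h, -⟩
    · exact ih hx.2 h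
    · exact absurd (List.cons.inj h).1 hx.1

theorem pattern_eq (k p q : ℕ) (T : List ℕ) :
    pattern k p q T = List.range' 1 k ++
      (List.replicate p (k + 1) ++ (k + 2) :: List.replicate q (k + 1) ++ T) := by
  simp [pattern, shift, oneTwoOne, Nat.add_comm]

theorem contains_pattern_iff {n : ℕ} {π : Fin n → ℕ} (hπ : IsRestrictedGrowth (List.ofFn π))
    {k p q : ℕ} (hp : 1 ≤ p) {T : List ℕ} (hT : ∀ t ∈ T, 1 ≤ t ∧ t ≤ k) :
    Contains π (pattern k p q T) ↔ HasTail k p q T (List.ofFn π) := by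
  rw [contains_iff_exists_map_sublist, pattern_eq]
  constructor
  · rintro ⟨b, hb, hs⟩
    have hmem : ∀ t, 1 ≤ t → t ≤ k + 2 → t ∈ List.range' 1 k ++
        (List.replicate p (k + 1) ++ (k + 2) :: List.replicate q (k + 1) ++ T) := by
      intro t h1 h2
      simp
      omega
    have hpos : ∀ t, 1 ≤ t → t ≤ k + 2 → 0 < b t := fun t h1 h2 =>
      hπ.1 _ (hs.subset (List.mem_map_of_mem (hmem t h1 h2)))
    -- `0` is not a letter of the pattern, so `b 0` is arbitrary; the value `0` lies below all
    -- letters of the word.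
    refine ⟨fun t => if t = 0 then 0 else b t, b (k + 1), b (k + 2), ?_, ?_, ?_, ?_⟩
    · intro s hs' t ht hst
      simp only [Set.mem_Iic] at hs' ht
      dsimp only
      rw [if_neg (by omega : t ≠ 0)]
      split_ifs with h0
      · exact hpos t (by omega) (by omega)
      · exact hb (hmem s (by omega) (by omega)) (hmem t (by omega) (by omega)) hst
    · dsimp only
      split_ifs with h0
      · exact hpos _ (by omega) (by omega)
      · exact hb (hmem k (by omega) (by omega)) (hmem (k + 1) (by omega) (by omega)) (by omega)
    · exact hb (hmem (k + 1) (by omega) (by omega)) (hmem (k + 2) (by omega) (by omega)) (by omega)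
    · have hTb : T.map (fun t => if t = 0 then 0 else b t) = T.map b := by
        refine List.map_congr_left fun t ht => if_neg ?_
        have := (hT t ht).1
        omega
      rw [hTb]
      rw [List.map_append] at hs
      simpa using (List.sublist_append_right _ _).trans hs
  · rintro ⟨a, c, d, ha, hac, hcd, hs⟩
    obtain ⟨p, rfl⟩ := Nat.exists_eq_add_of_le' hp
    set b : ℕ → ℕ := fun t => if t ≤ k then a t else if t = k + 1 then c else d with hb
    have hbk : ∀ t, t ≤ k → b t = a t := fun t ht => if_pos ht
    have hb1 : b (k + 1) = c := by simp [hb]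
    have hb2 : b (k + 2) = d := by simp [hb]
    have hak : ∀ t, t ≤ k → a t ≤ a k := fun t ht =>
      ha.monotoneOn (Set.mem_Iic.2 ht) (Set.mem_Iic.2 le_rfl) ht
    refine ⟨b, ?_, ?_⟩
    · intro s hs' t ht hst
      have ht2 : t ≤ k + 2 := by
        simp at ht
        rcases ht with h | h | h | h | h
        · omega
        · omega
        · omega
        · omega
        · have := (hT t h).2
          omega
      rcases Nat.lt_or_ge k t with h | h
      · rcases Nat.lt_or_ge k s with h' | h'
        · obtain rfl : s = k + 1 := by omega
          obtain rfl : t = k + 2 := by omega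
          rwa [hb1, hb2]
        · have := hak s h'
          rw [hbk s h']
          rcases (by omega : t = k + 1 ∨ t = k + 2) with rfl | rfl
          · rw [hb1]; omega
          · rw [hb2]; omega
      · rw [hbk s (by omega), hbk t h]
        exact ha (Set.mem_Iic.2 (by omega)) (Set.mem_Iic.2 h) hst
    · have hTb : T.map b = T.map a := List.map_congr_left fun t ht => hbk t (hT t ht).2
      simp only [List.map_append, List.map_cons, List.map_replicate, hb1, hb2, hTb]
      rw [List.replicate_succ, List.cons_append, List.cons_append] at hs ⊢
      obtain ⟨l₁, l₂, hl, hn, hr⟩ := hπ.exists_eq_append (hs.subset List.mem_cons_self)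
      rw [hl] at hs ⊢
      -- The tail starts with `c`, so it fits after the cut at the first `c`; before the cut stands
      -- `1, …, c - 1`, which contains the increasing word `b 1, …, b k`.
      refine List.Sublist.append (List.Sublist.trans ?_ hr) (cons_sublist_of_append hn hs)
      have hpw : ((List.range' 1 k).map b).Pairwise (· < ·) := by
        rw [List.pairwise_map]
        refine (List.pairwise_lt_range' (s := 1) (n := k)).imp_of_mem fun {s t} hs' ht hst => ?_
        rw [List.mem_range'_1] at hs' ht
        rw [hbk s (by omega), hbk t (by omega)]
        exact ha (Set.mem_Iic.2 (by omega)) (Set.mem_Iic.2 (by omega)) hst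
      refine List.sublist_of_subperm_of_pairwise
        (List.subperm_of_subset (hpw.imp fun h => h.ne) ?_) hpw List.pairwise_lt_range'
      intro x hx
      obtain ⟨t, ht, rfl⟩ := List.mem_map.1 hx
      rw [List.mem_range'_1] at ht ⊢
      have h1 := ha (Set.mem_Iic.2 (Nat.zero_le k)) (Set.mem_Iic.2 (by omega : t ≤ k))
        (by omega : 0 < t)
      have h2 := hak t (by omega)
      rw [hbk t (by omega)]
      omega

/-! ### Set partitions as restricted growth words -/

theorem isRestrictedGrowth_ofFn_iff {n : ℕ} (π : Fin n → ℕ) :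
    IsRestrictedGrowth (List.ofFn π) ↔
      (∀ i, 1 ≤ π i) ∧ ∀ i c, 1 ≤ c → c < π i → ∃ j < i, π j = c := by
  refine and_congr (by simp) ⟨fun h i c hc hci => ?_, fun h c hc x hx => ?_⟩
  · have h := h c hc
    rw [List.head?_filter] at h
    rcases hf : (List.ofFn π).find? (c ≤ ·) with _ | x
    · rw [List.find?_eq_none] at hf
      exact absurd (decide_eq_true hci.le) (hf (π i) (by simp))
    · obtain rfl := h x hf
      obtain ⟨-, j, hj, hjx, hlt⟩ := List.find?_eq_some_iff_getElem.1 hf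
      have hjn : j < n := by simpa using hj
      simp only [List.getElem_ofFn] at hjx hlt
      refine ⟨⟨j, hjn⟩, ?_, hjx⟩
      by_contra hij
      rcases (not_lt.1 hij).eq_or_lt with h1 | h1
      · rw [h1, hjx] at hci
        exact lt_irrefl _ hci
      · have := hlt i h1
        simp at this
        omega
  · rw [List.head?_filter] at hx
    obtain ⟨hcx, j, hj, hjx, hlt⟩ := List.find?_eq_some_iff_getElem.1 hx
    have hjn : j < n := by simpa using hj
    simp only [List.getElem_ofFn] at hjx hlt
    by_contra hne
    simp at hcx
    obtain ⟨j', hj', h'⟩ := h ⟨j, hjn⟩ c hc (by rw [hjx]; omega)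
    have := hlt j' hj'
    simp [h'] at this

section canonicalSeq

variable {n : ℕ} (P : SetPartition n)

theorem eq_of_min_eq_min {B C : Finset (Fin n)} (hB : B ∈ P.parts) (hC : C ∈ P.parts)
    (h : B.min = C.min) : B = C := by
  obtain ⟨m, hm⟩ := Finset.min_of_nonempty (P.nonempty_of_mem_parts hB)
  exact P.eq_of_mem_parts hB hC (Finset.mem_of_min hm) (Finset.mem_of_min (h ▸ hm))

theorem card_filter_min_lt {B C : Finset (Fin n)} (hC : C ∈ P.parts) (h : B.min < C.min) :
    (P.parts.filter fun D => D.min ≤ B.min).card < (P.parts.filter fun D => D.min ≤ C.min).card := by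
  refine Finset.card_lt_card (Finset.ssubset_iff_of_subset ?_ |>.2 ⟨C, ?_, ?_⟩)
  · intro D hD
    simp only [Finset.mem_filter] at hD ⊢
    exact ⟨hD.1, hD.2.trans h.le⟩
  · exact Finset.mem_filter.2 ⟨hC, le_rfl⟩
  · exact fun h' => (Finset.mem_filter.1 h').2.not_gt h

theorem card_filter_min_injOn :
    Set.InjOn (fun B : Finset (Fin n) => (P.parts.filter fun D => D.min ≤ B.min).card)
      P.parts := by
  intro B hB C hC h
  refine eq_of_min_eq_min P hB hC ?_
  by_contra hne
  rcases lt_or_gt_of_ne hne with h' | h'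
  · exact (card_filter_min_lt P hC h').ne h
  · exact (card_filter_min_lt P hB h').ne' h

theorem canonicalSeq_eq_iff (i j : Fin n) :
    canonicalSeq P i = canonicalSeq P j ↔ i ∈ P.part j := by
  rw [P.mem_part_iff_part_eq_part (Finset.mem_univ _) (Finset.mem_univ _)]
  refine ⟨fun h => ?_, fun h => by rw [canonicalSeq, canonicalSeq, h]⟩
  exact card_filter_min_injOn P (P.part_mem.2 (Finset.mem_univ _))
    (P.part_mem.2 (Finset.mem_univ _)) h

theorem canonicalSeq_injective : Function.Injective (canonicalSeq (n := n)) := by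
  intro P Q h
  have hpart : ∀ i, P.part i = Q.part i := by
    intro i
    ext j
    rw [← canonicalSeq_eq_iff, ← canonicalSeq_eq_iff, h]
  have hsub : ∀ P Q : SetPartition n, (∀ i, P.part i = Q.part i) → P.parts ⊆ Q.parts := by
    intro P Q hpart B hB
    obtain ⟨m, hm⟩ := P.nonempty_of_mem_parts hB
    rw [← P.part_eq_of_mem hB hm, hpart]
    exact Q.part_mem.2 (Finset.mem_univ _)
  exact Finpartition.ext ((hsub P Q hpart).antisymm (hsub Q P fun i => (hpart i).symm))

theorem isRestrictedGrowth_canonicalSeq : IsRestrictedGrowth (List.ofFn (canonicalSeq P)) := by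
  rw [isRestrictedGrowth_ofFn_iff]
  have hpos : ∀ B ∈ P.parts, 1 ≤ (P.parts.filter fun D => D.min ≤ B.min).card := fun B hB =>
    Finset.card_pos.2 ⟨B, Finset.mem_filter.2 ⟨hB, le_rfl⟩⟩
  refine ⟨fun i => hpos _ (P.part_mem.2 (Finset.mem_univ _)), fun i c hc hci => ?_⟩
  set S := P.parts.filter fun D => D.min ≤ (P.part i).min with hS
  -- Block indices are injective on `S` and lie between `1` and the size of `S`, so every index is
  -- attained.
  have himg : S.image (fun B => (P.parts.filter fun D => D.min ≤ B.min).card) =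
      Finset.Icc 1 S.card := by
    refine Finset.eq_of_subset_of_card_le ?_ ?_
    · intro v hv
      obtain ⟨B, hB, rfl⟩ := Finset.mem_image.1 hv
      rw [hS, Finset.mem_filter] at hB
      rw [Finset.mem_Icc]
      refine ⟨hpos B hB.1, Finset.card_le_card fun D hD => ?_⟩
      rw [Finset.mem_filter] at hD
      rw [hS, Finset.mem_filter]
      exact ⟨hD.1, hD.2.trans hB.2⟩
    · rw [Finset.card_image_of_injOn
        ((card_filter_min_injOn P).mono (Finset.coe_subset.2 (Finset.filter_subset _ _)))]
      rw [Nat.card_Icc, Nat.add_sub_cancel]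
  have hcS : c ∈ Finset.Icc 1 S.card := Finset.mem_Icc.2 ⟨hc, hci.le⟩
  rw [← himg] at hcS
  obtain ⟨B, hB, rfl⟩ := Finset.mem_image.1 hcS
  rw [hS, Finset.mem_filter] at hB
  obtain ⟨j, hj⟩ := Finset.min_of_nonempty (P.nonempty_of_mem_parts hB.1)
  refine ⟨j, ?_, ?_⟩
  · have hlt : B.min < (P.part i).min := by
      refine lt_of_le_of_ne hB.2 fun h => hci.ne ?_
      simp only [canonicalSeq, h]
    rw [hj] at hlt
    exact WithTop.coe_lt_coe.1
      (hlt.trans_le (Finset.min_le (P.mem_part (Finset.mem_univ i))))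
  · rw [canonicalSeq, P.part_eq_of_mem hB.1 (Finset.mem_of_min hj)]

end canonicalSeq

theorem exists_canonicalSeq_eq {n : ℕ} {π : Fin n → ℕ}
    (hπ : IsRestrictedGrowth (List.ofFn π)) : ∃ P : SetPartition n, canonicalSeq P = π := by
  rw [isRestrictedGrowth_ofFn_iff] at hπ
  obtain ⟨h1, h2⟩ := hπ
  let _ : DecidableRel (Setoid.ker π).r := fun i j => inferInstanceAs (Decidable (π i = π j))
  set P : SetPartition n := Finpartition.ofSetoid (Setoid.ker π) with hP
  have hpart : ∀ i, P.part i = Finset.univ.filter (fun j => π j = π i) := by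
    intro i
    ext j
    rw [hP, Finpartition.mem_part_ofSetoid_iff_rel]
    simp [Setoid.ker_def, eq_comm]
  have hmem : ∀ i, P.part i ∈ P.parts := fun i => P.part_mem.2 (Finset.mem_univ _)
  have hle : ∀ i c, 1 ≤ c → c ≤ π i → ∃ j ≤ i, π j = c := by
    intro i c hc hci
    rcases hci.eq_or_lt with rfl | h
    · exact ⟨i, le_rfl, rfl⟩
    · obtain ⟨j, hj, h⟩ := h2 i c hc h
      exact ⟨j, hj.le, h⟩
  refine ⟨P, funext fun i => ?_⟩
  rw [canonicalSeq]
  have hcard : (Finset.Icc 1 (π i)).card = π i := by simp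
  rw [← hcard]
  symm
  -- The values `1, …, π i` correspond to their fibres, which are the blocks opened no later than
  -- that of `i`.
  refine Finset.card_bij (fun v _ => Finset.univ.filter (fun j => π j = v)) ?_ ?_ ?_
  · intro v hv
    rw [Finset.mem_Icc] at hv
    obtain ⟨m, hm⟩ := Finset.min_of_nonempty (P.nonempty_of_mem_parts (hmem i))
    have hmi : π m = π i := by simpa [hpart] using Finset.mem_of_min hm
    obtain ⟨j, hj, rfl⟩ := hle m v hv.1 (hmi ▸ hv.2)
    rw [Finset.mem_filter, ← hpart, hm]
    exact ⟨hmem j, (Finset.min_le (P.mem_part (Finset.mem_univ j))).trans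
      (WithTop.coe_le_coe.2 hj)⟩
  · intro v hv w _ h
    rw [Finset.mem_Icc] at hv
    obtain ⟨j, -, rfl⟩ := hle i v hv.1 hv.2
    have : j ∈ Finset.univ.filter (fun j' => π j' = π j) := by simp
    rw [h] at this
    simpa using this
  · intro B hB
    rw [Finset.mem_filter] at hB
    obtain ⟨j, hj⟩ := Finset.min_of_nonempty (P.nonempty_of_mem_parts hB.1)
    refine ⟨π j, Finset.mem_Icc.2 ⟨h1 j, ?_⟩, ?_⟩
    · by_contra hlt
      obtain ⟨j', hj', h'⟩ := h2 j (π i) (h1 i) (not_le.1 hlt)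
      have h3 : (P.part i).min ≤ j' := Finset.min_le (by simp [hpart, h'])
      have h4 := hB.2.trans h3
      rw [hj] at h4
      exact absurd (WithTop.coe_le_coe.1 h4) (not_le.2 hj')
    · rw [← hpart, P.part_eq_of_mem hB.1 (Finset.mem_of_min hj)]

/-! ### Counting avoiders; the patterns are partitions -/

theorem ncard_avoiders_pattern {k p q : ℕ} (hp : 1 ≤ p) {T : List ℕ}
    (hT : ∀ t ∈ T, 1 ≤ t ∧ t ≤ k) (n : ℕ) :
    (avoiders n (pattern k p q T)).ncard =
      {l | IsRestrictedGrowth l ∧ l.length = n ∧ ¬ HasTail k p q T l}.ncard := by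
  rw [← Set.ncard_image_of_injective _
    (List.ofFn_injective.comp (canonicalSeq_injective (n := n)))]
  congr 1
  ext l
  simp only [Set.mem_image, Function.comp_apply, avoiders, Set.mem_ofPred_eq]
  constructor
  · rintro ⟨P, hP, rfl⟩
    have h := isRestrictedGrowth_canonicalSeq P
    exact ⟨h, by simp, by rwa [← contains_pattern_iff h hp hT]⟩
  · rintro ⟨h, rfl, hl⟩
    rw [← List.ofFn_get l] at h hl
    obtain ⟨P, hP⟩ := exists_canonicalSeq_eq h
    exact ⟨P, by rwa [hP, contains_pattern_iff h hp hT], by rw [hP, List.ofFn_get]⟩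

theorem IsRestrictedGrowth.append {l m : List ℕ} (hl : IsRestrictedGrowth l)
    (hm : ∀ x ∈ m, 1 ≤ x ∧ (x = 1 ∨ x - 1 ∈ l ∨ x ∈ l)) : IsRestrictedGrowth (l ++ m) := by
  refine ⟨fun x hx => ?_, fun c hc x hx => ?_⟩
  · rcases List.mem_append.1 hx with h | h
    · exact hl.1 x h
    · exact (hm x h).1
  · rw [List.filter_append, List.head?_append] at hx
    rcases h : l.filter (c ≤ ·) with _ | ⟨y, l'⟩
    · rw [h] at hx
      have hxm := List.mem_filter.1 (List.mem_of_mem_head? hx)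
      have hlt : ∀ y ∈ l, y < c := by simpa using h
      have h1 := hm x hxm.1
      have h2 := hxm.2
      simp only [decide_eq_true_eq] at h2
      rcases h1.2 with h3 | h3 | h3
      · omega
      · have := hlt _ h3
        omega
      · have := hlt _ h3
        omega
    · refine hl.2 c hc x ?_
      rw [h] at hx ⊢
      exact hx

theorem isRestrictedGrowth_pattern {k p q : ℕ} (hp : 1 ≤ p) {T : List ℕ}
    (hT : ∀ t ∈ T, 1 ≤ t ∧ t ≤ k) : IsRestrictedGrowth (pattern k p q T) := by
  have hrange : ∀ k, IsRestrictedGrowth (List.range' 1 k) := by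
    intro k
    induction k with
    | zero => simp [IsRestrictedGrowth]
    | succ k ih =>
      rw [List.range'_concat]
      refine ih.append ?_
      simp
      omega
  rw [pattern_eq, ← List.append_assoc, ← List.append_assoc]
  refine (((hrange k).append ?_).append ?_).append ?_
  · intro x hx
    obtain rfl := List.eq_of_mem_replicate hx
    simp
    omega
  · intro x hx
    simp at hx ⊢
    omega
  · intro x hx
    have := hT x hx
    simp
    omega

theorem isPartitionWord_of_isRestrictedGrowth {σ : List ℕ} (h : IsRestrictedGrowth σ) :
    IsPartitionWord σ := by
  rw [← List.ofFn_get σ] at h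
  obtain ⟨P, hP⟩ := exists_canonicalSeq_eq h
  exact ⟨P, congrFun hP⟩

end PartitionPattern

theorem theorem3p20 (k p q : ℕ) (hp : 1 ≤ p) (T : List ℕ) (hT : ∀ t ∈ T, 1 ≤ t ∧ t ≤ k) :
    PartitionPattern.IsPartitionWord (PartitionPattern.pattern k p q T) ∧
    PartitionPattern.IsPartitionWord (PartitionPattern.pattern k (p + q) 0 T) ∧
    PartitionPattern.Equivalent
      (PartitionPattern.pattern k p q T) (PartitionPattern.pattern k (p + q) 0 T) := by
  have hpq : 1 ≤ p + q := by omega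
  refine ⟨PartitionPattern.isPartitionWord_of_isRestrictedGrowth
      (PartitionPattern.isRestrictedGrowth_pattern hp hT),
    PartitionPattern.isPartitionWord_of_isRestrictedGrowth
      (PartitionPattern.isRestrictedGrowth_pattern hpq hT), fun n => ?_⟩
  rw [PartitionPattern.ncard_avoiders_pattern hp hT, PartitionPattern.ncard_avoiders_pattern hpq hT,
    PartitionPattern.ncard_not_hasTail_eq hp fun t ht => (hT t ht).2]
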